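/- Let $F$ be a finite field of odd characteristic with $q$ elements, $E/F$ a finite extension of degree $f$, and $\sigma(x)=x^q$ the Frobenius of $E/F$, acting entrywise on matrices. Let $H\subset \mathrm{PGL}_2(E)$ be the split torus of diagonal matrices and, for a fixed non-square $\alpha\in E^\times$, let $K\subset\mathrm{PGL}_2(E)$ be the non-split torus of classes of invertible matrices $\begin{pmatrix} x&\alpha z\\ z&x\end{pmatrix}$ with $x,z\in E$. For a character $\chi:E^\times\to\mathbb C^\times$ let $\mathrm{Ps}(\chi,\chi^{-1})$ be the space of functions $\phi:\mathrm{PGL}_2(E)\to\mathbb C$ with $\phi\left(\begin{pmatrix} a&b\\0&1\end{pmatrix}g\right)=\chi(a)\phi(g)$ for all $a\in E^\times$, $b\in E$, $g\in\mathrm{PGL}_2(E)$, on which $\mathrm{PGL}_2(E)$ acts by right translation. Representations of $\mathrm{PGL}_2$ are also regarded as representations of $\mathrm{GL}_2$ with trivial central character. A representation $\pi$ of $\mathrm{PGL}_2(E)$ is the (Shintani) base change of a representation $\tau$ of $\mathrm{PGL}_2(F)$ with character $\chi_\tau$ if there is a linear operator $T$ on the space of $\pi$ with $T\pi(g)=\pi(g^\sigma)T$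 and $\mathrm{Trace}(\pi(g)T)=\chi_\tau(\mathrm N(g))$ for all $g\in\mathrm{GL}_2(E)$, where $\mathrm N(g)=g\,g^{\sigma}\cdots g^{\sigma^{f-1}}$ and $\chi_\tau(\mathrm N(g))$ is the value of $\chi_\tau$ at any element of $\mathrm{GL}_2(F)$ that is conjugate to $\mathrm N(g)$ in $\mathrm{GL}_2(E)$. Let $\pi=\mathrm{Ps}(\chi,\chi^{-1})$ be an irreducible principal series representation of $\mathrm{PGL}_2(E)$ which is the base change of an irreducible complex representation $\tau$ of $\mathrm{PGL}_2(F)$. Let $\langle\ ,\ \rangle_\pi$ be a $\mathrm{PGL}_2(E)$-invariant inner product on $\pi$, and let $v_H$ (resp. $v_K$) be an $H$-invariant (resp. $K$-invariant) unit vector in $\pi$. Let $\varepsilon_\tau$ be the sign of $\tau$: the trace of $\tau(k_0)$, where $k_0=\begin{pmatrix}0&\beta\\1&0\end{pmatrix}$ with $\beta\in F^\times$ a non-square, on the space of vectors of $\tau$ fixed by the diagonal torus of $\mathrm{PGL}_2(F)$ (for the representations $\tau$ in question this space is a line, so that $\varepsilon_\tau=\pm1$ is the scalar by which $k_0$ acts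 on it). Then $$\langle v_H,v_K\rangle_\pi=\varepsilon_\tau\,\langle v_H,v_K\rangle_\pi .$$ In particular, $v_H$ and $v_K$ are orthogonal if $\varepsilon_\tau=-1$. -/

import Mathlib

open scoped MatrixGroups

namespace ToricBC

noncomputable section

/-- `PGL₂(E) = GL₂(E) / centre`. -/
abbrev PGL2 (E : Type*) [Field E] : Type _ :=
  GL (Fin 2) E ⧸ Subgroup.center (GL (Fin 2) E)

/-- The quotient map `GL₂(E) → PGL₂(E)`. -/
abbrev toPGL2 (E : Type*) [Field E] : GL (Fin 2) E →* PGL2 E :=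
  QuotientGroup.mk' (Subgroup.center (GL (Fin 2) E))

/-- The matrix `(a b; 0 1)` as an element of `GL₂(E)`. -/
def mirabolic {E : Type*} [Field E] (a : Eˣ) (b : E) : GL (Fin 2) E :=
  Matrix.GeneralLinearGroup.mkOfDetNeZero !![(a : E), b; 0, 1] (by simp)

/-- The matrix `k₀ = (0 β; 1 0)` (for `β ≠ 0`) as an element of `GL₂(E)`. -/
def antiDiag {E : Type*} [Field E] (β : Eˣ) : GL (Fin 2) E :=
  Matrix.GeneralLinearGroup.mkOfDetNeZero !![0, (β : E); 1, 0] (by simp)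

/-- The split torus of diagonal matrices in `GL₂(E)`. -/
def splitTorusGL (E : Type*) [Field E] : Subgroup (GL (Fin 2) E) where
  carrier := {g | g 0 1 = 0 ∧ g 1 0 = 0}
  mul_mem' := by
    rintro a b ⟨ha, ha'⟩ ⟨hb, hb'⟩
    simp [Matrix.mul_apply, Fin.sum_univ_two, ha, ha', hb, hb']
  one_mem' := by simp
  inv_mem' := by
    rintro a ⟨ha, ha'⟩
    simp [Matrix.inv_def, Matrix.adjugate_fin_two, ha, ha']

/-- The torus of invertible matrices `(x αz; z x)` in `GL₂(E)`. It is the multiplicative group of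
the algebra `E[√α]`, hence a non-split torus when `α` is not a square in `E`. -/
def nonsplitTorusGL {E : Type*} [Field E] (α : E) : Subgroup (GL (Fin 2) E) where
  carrier := {g | g 0 0 = g 1 1 ∧ g 0 1 = α * g 1 0}
  mul_mem' := by
    rintro a b ⟨ha, ha'⟩ ⟨hb, hb'⟩
    simp only [Set.mem_ofPred_eq, Units.val_mul, Matrix.mul_apply, Fin.sum_univ_two, ha, ha', hb,
      hb']
    constructor <;> ring
  one_mem' := by simp
  inv_mem' := by
    rintro a ⟨ha, ha'⟩
    simp [Matrix.inv_def, Matrix.adjugate_fin_two, ha, ha']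
    ring

/-- The split torus `H` of `PGL₂(E)`. -/
def splitTorus (E : Type*) [Field E] : Subgroup (PGL2 E) :=
  (splitTorusGL E).map (toPGL2 E)

/-- The torus `K = K_α` of `PGL₂(E)`, consisting of the classes of the invertible matrices
`(x αz; z x)`. -/
def nonsplitTorus {E : Type*} [Field E] (α : E) : Subgroup (PGL2 E) :=
  (nonsplitTorusGL α).map (toPGL2 E)

/-- The space `π^S` of vectors fixed by the subgroup `S`. -/
def fixedVectors {G V : Type*} [Group G] [AddCommGroup V] [Module ℂ V]
    (π : Representation ℂ G V) (S : Subgroup G) : Submodule ℂ V where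
  carrier := {v | ∀ s ∈ S, π s v = v}
  add_mem' := by
    intro a b ha hb s hs
    rw [map_add, ha s hs, hb s hs]
  zero_mem' := by
    intro s _
    exact map_zero _
  smul_mem' := by
    intro c v hv s hs
    rw [map_smul, hv s hs]

/-- The space of the principal series `Ps(χ, χ⁻¹)`: functions `f : PGL₂(E) → ℂ` such that
`f ((a b; 0 1) g) = χ(a) f(g)`. -/
def psSpace {E : Type*} [Field E] (χ : Eˣ →* ℂˣ) : Submodule ℂ (PGL2 E → ℂ) where
  carrier := {f | ∀ (a : Eˣ) (b : E) (g : PGL2 E),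
    f (toPGL2 E (mirabolic a b) * g) = (χ a : ℂ) * f g}
  add_mem' := by
    intro f f' hf hf' a b g
    simp only [Pi.add_apply, hf a b g, hf' a b g]
    ring
  zero_mem' := by
    intro a b g
    simp
  smul_mem' := by
    intro c f hf a b g
    simp only [Pi.smul_apply, smul_eq_mul, hf a b g]
    ring

/-- The principal series representation `Ps(χ, χ⁻¹)` of `PGL₂(E)`, acting by right translation. -/
def principalSeries {E : Type*} [Field E] (χ : Eˣ →* ℂˣ) :
    Representation ℂ (PGL2 E) (psSpace χ) where
  toFun g :=
    { toFun := fun f => ⟨fun x => f.1 (x * g), fun a b x => by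
        simpa only [mul_assoc] using f.2 a b (x * g)⟩
      map_add' := fun _ _ => rfl
      map_smul' := fun _ _ => rfl }
  map_one' := by
    ext f x
    simp
  map_mul' := by
    intro g h
    ext f x
    simp [mul_assoc]

section BaseChange

variable (F E : Type*) [Field F] [Fintype F] [Field E] [Fintype E] [Algebra F E]

/-- The Frobenius `σ(x) = x ^ |F|` acting entrywise on `GL₂(E)`. -/
def frob : GL (Fin 2) E →* GL (Fin 2) E :=
  Matrix.GeneralLinearGroup.map (FiniteField.frobeniusAlgHom F E : E →+* E)

/-- The norm `N(g) = g g^σ g^{σ²} ⋯ g^{σ^{f-1}}`, where `f = [E : F]`. -/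
def shintaniNorm (g : GL (Fin 2) E) : GL (Fin 2) E :=
  ((List.range (Module.finrank F E)).map fun i => (frob F E)^[i] g).prod

variable {F E}

/-- `π` is the Shintani base change of `τ`: there is a (suitably normalized) operator `T` on the
space of `π` that intertwines `π` with its Frobenius twist, `T π(g) = π(g^σ) T`, and satisfies
`Trace (π(g) T) = χ_τ(N(g))` for all `g ∈ GL₂(E)`. Here `χ_τ(N(g))` is the value of the character
of `τ` at any `x ∈ GL₂(F)` that is conjugate to `N(g)` in `GL₂(E)`; the representations
of `PGL₂` are regarded as representations of `GL₂` with trivial central character. -/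
def IsShintaniBaseChange {W V : Type*} [AddCommGroup W] [Module ℂ W] [AddCommGroup V] [Module ℂ V]
    (τ : Representation ℂ (PGL2 F) W) (π : Representation ℂ (PGL2 E) V) : Prop :=
  ∃ T : V →ₗ[ℂ] V,
    (∀ g : GL (Fin 2) E, T ∘ₗ π (toPGL2 E g) = π (toPGL2 E (frob F E g)) ∘ₗ T) ∧
    ∀ (g : GL (Fin 2) E) (x : GL (Fin 2) F),
      IsConj (shintaniNorm F E g) (Matrix.GeneralLinearGroup.map (algebraMap F E) x) →
        LinearMap.trace ℂ V (π (toPGL2 E g) ∘ₗ T) = LinearMap.trace ℂ W (τ (toPGL2 F x))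

end BaseChange

/-- `k₀ = (0 β; 1 0)` normalizes `H`, hence preserves the space of `H`-fixed vectors. -/
theorem antiDiag_mapsTo {F W : Type*} [Field F] [AddCommGroup W] [Module ℂ W]
    (τ : Representation ℂ (PGL2 F) W) (β : Fˣ) :
    ∀ w ∈ fixedVectors τ (splitTorus F),
      τ (toPGL2 F (antiDiag β)) w ∈ fixedVectors τ (splitTorus F) := by
  rintro w hw _ ⟨h, hh, rfl⟩
  have hconj : (antiDiag β)⁻¹ * h * antiDiag β ∈ splitTorusGL F := by
    obtain ⟨h1, h2⟩ := hh
    constructor <;>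
      simp [antiDiag, Matrix.mul_apply, Fin.sum_univ_two, Matrix.inv_def, Matrix.adjugate_fin_two,
        Matrix.GeneralLinearGroup.mkOfDetNeZero, Matrix.vecMul, dotProduct, h1, h2]
  have key := hw _ ⟨_, hconj, rfl⟩
  have e : toPGL2 F h * toPGL2 F (antiDiag β) =
      toPGL2 F (antiDiag β) * toPGL2 F ((antiDiag β)⁻¹ * h * antiDiag β) := by
    rw [← map_mul, ← map_mul]
    congr 1
    group
  rw [← Module.End.mul_apply, ← map_mul, e, map_mul, Module.End.mul_apply, key]

/-- The sign `ε_τ`: the trace of `k₀ = (0 β; 1 0)` on the space `τ^H`. For `τ` a principal series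
or a cuspidal representation this space is a line `ℂ v_H`, and the trace is the scalar `±1` by
which `k₀` acts on it, `τ(k₀) v_H = ε_τ v_H`. -/
def epsilonSign {F W : Type*} [Field F] [AddCommGroup W] [Module ℂ W]
    (τ : Representation ℂ (PGL2 F) W) (β : Fˣ) : ℂ :=
  LinearMap.trace ℂ (fixedVectors τ (splitTorus F))
    ((τ (toPGL2 F (antiDiag β))).restrict (antiDiag_mapsTo τ β))

end

end ToricBC

namespace ToricBC

noncomputable section

/-! The operator `T` of the base change is tested on `v_H` and `v_K`; both fixed spaces are lines,
so its effect there can be read off from averaged traces.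

On `H`, the norm of `diag(a,1)` is `diag(N a,1)`, and the field norm is surjective. Hence `T v_H = n
v_H` with `n = dim τ^H` (`map_splitTorus_vector`). Frobenius does not fix `K`, but carries it to its
conjugate by `diag(γ,1)`, where `γ = α^((q-1)/2)` has norm `-1`. Because of this `-1`, the Shintani
norms of `k diag(γ,1)⁻¹` have trace zero, so they are conjugate to the matrices `(0 b; 1 0)`, on
which `χ_τ` averages to `ε_τ`. Hence `T v_K = ε_τ π(diag(γ,1)) v_K` (`map_nonsplitTorus_vector`).

By Schur's lemma `⟨Tv, Tw⟩ = r ⟨v, w⟩` (`exists_inner_map_map`). Since `diag(γ,1)` lies in `H`, this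
gives `r ⟨v_H, v_K⟩ = n ε_τ ⟨v_H, v_K⟩`, while the unit vectors give `r = n² = ε_τ²`. Finally `r ≠
0` as `Trace T = dim τ`, and `n = 1`: from `ε_τ = ±n` the involution `k₀` is scalar on `τ^H`, and a
Gelfand-type transpose argument then bounds `n` by one. -/

/-- The average of a function over a finite type. -/
def mean (S : Type*) [Fintype S] {M : Type*} [AddCommGroup M] [Module ℂ M] (f : S → M) : M :=
  (Fintype.card S : ℂ)⁻¹ • ∑ s, f s

theorem map_mean {S : Type*} [Fintype S] {M N : Type*} [AddCommGroup M] [Module ℂ M] [AddCommGroup N] [Module ℂ N]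
    (L : M →ₗ[ℂ] N) (f : S → M) : L (mean S f) = mean S fun s => L (f s) := by
  simp [mean]

/-! ### Averages over finite groups and traces of projections -/

section Average

variable {G S V : Type*} [Group G] [Group S] [Fintype S] [AddCommGroup V] [Module ℂ V]

/-- The double sum of `f (b * φ a)` is evaluated in both orders, using translation invariance on
each group. This transfers averages over tori of `E` to averages over `Fˣ` along norm maps. -/
theorem mean_comp_of_surjective {A B : Type*} [Group A] [Group B] [Fintype A] [Fintype B]
    (φ : A →* B) (hφ : Function.Surjective φ) (f : B → ℂ) :
    mean A (fun a => f (φ a)) = mean B f := by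
  have key : (Fintype.card B : ℂ) * ∑ a, f (φ a) = (Fintype.card A : ℂ) * ∑ b, f b := by
    have h1 : ∀ b : B, ∑ a, f (b * φ a) = ∑ a, f (φ a) := by
      intro b
      obtain ⟨c, rfl⟩ := hφ b
      simp_rw [← map_mul]
      exact Equiv.sum_comp (Equiv.mulLeft c) fun a => f (φ a)
    have h2 : ∀ a : A, ∑ b, f (b * φ a) = ∑ b, f b := fun a =>
      Equiv.sum_comp (Equiv.mulRight (φ a)) f
    calc (Fintype.card B : ℂ) * ∑ a, f (φ a) = ∑ b : B, ∑ a, f (b * φ a) := by simp [h1]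
      _ = ∑ a : A, ∑ b, f (b * φ a) := Finset.sum_comm
      _ = _ := by simp [h2]
  have hA : (Fintype.card A : ℂ) ≠ 0 := by simp
  have hB : (Fintype.card B : ℂ) ≠ 0 := by simp
  simp only [mean, smul_eq_mul]
  field_simp
  linear_combination key

theorem mean_comp_equiv {A B : Type*} [Fintype A] [Fintype B] {M : Type*} [AddCommGroup M]
    [Module ℂ M] (e : A ≃ B) (f : B → M) :
    mean A (fun a => f (e a)) = mean B f := by
  simp only [mean, Equiv.sum_comp e f, Fintype.card_congr e]

/-- The operator averaging `π` over the image of a homomorphism from a finite group. -/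
def averaging (π : Representation ℂ G V) (φ : S →* G) : V →ₗ[ℂ] V :=
  mean S fun s => π (φ s)

theorem averaging_apply (π : Representation ℂ G V) (φ : S →* G) (v : V) :
    averaging π φ v = mean S fun s => π (φ s) v := by
  simp [averaging, mean]

theorem averaging_comp (π : Representation ℂ G V) (φ : S →* G) (A : V →ₗ[ℂ] V) :
    averaging π φ ∘ₗ A = mean S fun s => π (φ s) ∘ₗ A :=
  map_mean (LinearMap.lcomp ℂ V A) _

theorem map_comp_averaging (π : Representation ℂ G V) (φ : S →* G) (s : S) :
    π (φ s) ∘ₗ averaging π φ = averaging π φ := by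
  have h := map_mean (LinearMap.llcomp ℂ V V V (π (φ s))) fun t => π (φ t)
  refine h.trans ?_
  refine Eq.trans ?_ (mean_comp_equiv (Equiv.mulLeft s) fun t => π (φ t))
  congr 1
  ext t v
  simp

theorem averaging_comp_map (π : Representation ℂ G V) (φ : S →* G) (s : S) :
    averaging π φ ∘ₗ π (φ s) = averaging π φ := by
  rw [averaging_comp]
  refine Eq.trans ?_ (mean_comp_equiv (Equiv.mulRight s) fun t => π (φ t))
  congr 1
  ext t v
  simp

theorem isProj_averaging (π : Representation ℂ G V) (φ : S →* G) {U : Submodule ℂ V}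
    (hU : ∀ v, v ∈ U ↔ ∀ s, π (φ s) v = v) : LinearMap.IsProj U (averaging π φ) where
  map_mem v := by
    rw [hU]
    intro s
    exact congr($(map_comp_averaging π φ s) v)
  map_id v hv := by
    rw [hU] at hv
    rw [averaging_apply]
    simp [hv, mean, ← Nat.cast_smul_eq_nsmul ℂ]

theorem trace_averaging_comp (π : Representation ℂ G V) (φ : S →* G) (A : V →ₗ[ℂ] V) :
    LinearMap.trace ℂ V (averaging π φ ∘ₗ A) =
      mean S fun s => LinearMap.trace ℂ V (π (φ s) ∘ₗ A) := by
  rw [averaging_comp, map_mean]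

end Average

theorem trace_proj_comp {V : Type*} [AddCommGroup V] [Module ℂ V] [FiniteDimensional ℂ V]
    {U : Submodule ℂ V} {P : V →ₗ[ℂ] V} (hP : LinearMap.IsProj U P) (A : V →ₗ[ℂ] V)
    (hA : ∀ u ∈ U, A u ∈ U) :
    LinearMap.trace ℂ V (P ∘ₗ A) = LinearMap.trace ℂ U (A.restrict hA) := by
  have h1 : P = U.subtype ∘ₗ P.codRestrict U hP.map_mem := by ext; simp
  rw [LinearMap.trace_comp_comm', h1, ← LinearMap.comp_assoc, LinearMap.trace_comp_comm']
  congr 1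
  ext u
  simp [hP.map_id _ (hA u u.2), LinearMap.restrict_apply]

/-- Used to recover an eigenvalue of a twisted operator from character values, with `P` an averaging
operator. -/
theorem trace_proj_comp_of_eigenvector {V : Type*} [AddCommGroup V] [Module ℂ V]
    [FiniteDimensional ℂ V] {v : V} (hv : v ≠ 0) {P : V →ₗ[ℂ] V}
    (hP : LinearMap.IsProj (ℂ ∙ v) P) (A : V →ₗ[ℂ] V) {c : ℂ} (hA : A v = c • v) :
    LinearMap.trace ℂ V (P ∘ₗ A) = c := by
  have hA' : ∀ u ∈ ℂ ∙ v, A u = c • u := by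
    intro u hu
    obtain ⟨x, rfl⟩ := Submodule.mem_span_singleton.1 hu
    rw [map_smul, hA, smul_comm]
  rw [trace_proj_comp hP A fun u hu => by rw [hA' u hu]; exact Submodule.smul_mem _ _ hu]
  have : A.restrict (fun u hu => by rw [hA' u hu]; exact Submodule.smul_mem _ _ hu) =
      c • (LinearMap.id : (ℂ ∙ v) →ₗ[ℂ] (ℂ ∙ v)) := by
    ext u
    simp [LinearMap.restrict_apply, hA' u u.2]
  rw [this, map_smul, LinearMap.trace_id, finrank_span_singleton hv]
  simp

/-! ### Traces of involutions -/

section Involution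

variable {U : Type*} [AddCommGroup U] [Module ℂ U]

theorem isIdempotentElem_half_one_add {A : Module.End ℂ U} (hA : A * A = 1) :
    IsIdempotentElem ((1 / 2 : ℂ) • (1 + A)) := by
  have : (1 + A) * (1 + A) = (2 : ℂ) • (1 + A) := by
    rw [mul_add, add_mul, add_mul, hA, two_smul]
    simp
    abel
  rw [IsIdempotentElem, smul_mul_smul_comm, this, smul_smul]
  norm_num

theorem trace_involution [FiniteDimensional ℂ U] {A : Module.End ℂ U} (hA : A * A = 1) :
    ∃ m : ℤ, LinearMap.trace ℂ U A = m := by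
  have h := (LinearMap.IsIdempotentElem.isProj_range _ (isIdempotentElem_half_one_add hA)).trace
  rw [map_smul, map_add, LinearMap.trace_one, smul_eq_mul] at h
  refine ⟨2 * (Module.finrank ℂ (LinearMap.range ((1 / 2 : ℂ) • (1 + A)) : Submodule ℂ U) : ℤ) -
    Module.finrank ℂ U, ?_⟩
  push_cast
  rw [← h]
  ring

/-- The idempotent `(1 + A)/2` has trace zero, and in characteristic zero the trace of an idempotent
is its rank. -/
theorem involution_eq_neg_one [FiniteDimensional ℂ U] {A : Module.End ℂ U} (hA : A * A = 1)
    (h : LinearMap.trace ℂ U A = -Module.finrank ℂ U) : A = -1 := by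
  have h0 := LinearMap.IsIdempotentElem.eq_zero_of_trace_eq_zero
    (isIdempotentElem_half_one_add hA) (by
    rw [map_smul, map_add, LinearMap.trace_one, h]; simp)
  rw [smul_eq_zero_iff_right (by norm_num)] at h0
  rw [eq_neg_iff_add_eq_zero, add_comm, h0]

theorem involution_eq_one_or_neg_one [FiniteDimensional ℂ U] {A : Module.End ℂ U} (hA : A * A = 1)
    (h : LinearMap.trace ℂ U A ^ 2 = (Module.finrank ℂ U : ℂ) ^ 2) : A = 1 ∨ A = -1 := by
  rcases sq_eq_sq_iff_eq_or_eq_neg.1 h with h | h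
  · left
    have := involution_eq_neg_one (A := -A) (by simpa using hA) (by rw [map_neg, h])
    exact neg_injective this
  · exact Or.inr (involution_eq_neg_one hA h)

end Involution

/-! ### Irreducibility: multiplicity one and Schur's lemma -/

section Irreducible

variable {G V : Type*} [Group G] [AddCommGroup V] [Module ℂ V] {π : Representation ℂ G V}

theorem eq_top_of_invariant (hπ : π.IsIrreducible) {U : Submodule ℂ V}
    (hU : ∀ g, ∀ v ∈ U, π g v ∈ U) {v : V} (hv : v ∈ U) (hv0 : v ≠ 0) : U = ⊤ := by
  let U' : Subrepresentation π := ⟨U, fun g v hv => hU g v hv⟩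
  rcases hπ.eq_bot_or_eq_top U' with h | h
  · have : v ∈ U' := hv
    rw [h] at this
    exact absurd this hv0
  · exact congrArg Subrepresentation.toSubmodule h

theorem nontrivial_of_isIrreducible (hπ : π.IsIrreducible) : Nontrivial V := by
  by_contra hV
  rw [not_nontrivial_iff_subsingleton] at hV
  obtain ⟨x, y, hxy⟩ := hπ.toNontrivial
  exact hxy (Subrepresentation.toSubmodule_injective (Subsingleton.elim _ _))

theorem span_orbit_eq_top (hπ : π.IsIrreducible) {v : V} (hv : v ≠ 0) :
    Submodule.span ℂ (Set.range fun g => π g v) = ⊤ := by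
  refine eq_top_of_invariant hπ (fun g w hw => ?_) (Submodule.subset_span ⟨1, by simp⟩) hv
  induction hw using Submodule.span_induction with
  | mem x hx =>
    obtain ⟨k, rfl⟩ := hx
    exact Submodule.subset_span ⟨g * k, by simp⟩
  | zero => simp
  | add x y _ _ hx hy => rw [map_add]; exact Submodule.add_mem _ hx hy
  | smul c x _ hx => rw [map_smul]; exact Submodule.smul_mem _ _ hx

/-- If the compressions `P π(g) P` commute, the range of `P` is at most a line. -/
theorem finrank_le_one_of_commute [FiniteDimensional ℂ V] (hπ : π.IsIrreducible)
    {U : Submodule ℂ V} {P : V →ₗ[ℂ] V} (hP : LinearMap.IsProj U P)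
    (hcomm : ∀ g k : G, ∀ v ∈ U, P (π g (P (π k v))) = P (π k (P (π g v)))) :
    Module.finrank ℂ U ≤ 1 := by
  rcases subsingleton_or_nontrivial U with hU | hU
  · simp [Module.finrank_zero_of_subsingleton]
  -- The orbit of `w` spans `V`, so its projection spans `U`.
  have hspan : ∀ w ∈ U, w ≠ 0 → ∀ u ∈ U,
      u ∈ Submodule.span ℂ (Set.range fun g => P (π g w)) := by
    intro w _ hw0 u hu
    have h : u ∈ (Submodule.span ℂ (Set.range fun g => π g w)).map P :=
      ⟨u, by rw [span_orbit_eq_top hπ hw0]; trivial, hP.map_id u hu⟩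
    rwa [Submodule.map_span, ← Set.range_comp] at h
  -- An eigenvector `w` of one compression generates `U` under all compressions; as these commute,
  -- its eigenvalue propagates to all of `U`.
  have hscalar : ∀ g, ∃ c : ℂ, ∀ u ∈ U, P (π g u) = c • u := by
    intro g
    let X : Module.End ℂ U := (P ∘ₗ π g).restrict fun u _ => hP.map_mem _
    obtain ⟨c, hc⟩ := Module.End.exists_eigenvalue X
    obtain ⟨w, hw⟩ := hc.exists_hasEigenvector
    have hw1 : P (π g w) = c • (w : V) := congrArg Subtype.val hw.apply_eq_smul
    have hw0 : (w : V) ≠ 0 := fun h => hw.2 (Subtype.ext h)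
    refine ⟨c, fun u hu => ?_⟩
    have := hspan w w.2 hw0 u hu
    clear hu
    induction this using Submodule.span_induction with
    | mem x hx =>
      obtain ⟨k, rfl⟩ := hx
      change P (π g (P (π k w))) = c • P (π k w)
      rw [hcomm g k w w.2, hw1, map_smul, map_smul]
    | zero => simp
    | add x y _ _ hx hy => rw [map_add, map_add, hx, hy, smul_add]
    | smul a x _ hx => rw [map_smul, map_smul, hx, smul_comm]
  obtain ⟨w, hw⟩ := exists_ne (0 : U)
  have hw0 : (w : V) ≠ 0 := fun h => hw (Subtype.ext h)
  refine finrank_le_one w fun u => ?_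
  have h : (u : V) ∈ ℂ ∙ (w : V) := by
    refine Submodule.span_le.2 ?_ (hspan w w.2 hw0 u u.2)
    rintro _ ⟨g, rfl⟩
    obtain ⟨c, hc⟩ := hscalar g
    rw [SetLike.mem_coe, Submodule.mem_span_singleton]
    exact ⟨c, (hc w w.2).symm⟩
  obtain ⟨c, hc⟩ := Submodule.mem_span_singleton.1 h
  exact ⟨c, Subtype.ext hc⟩

end Irreducible

/-- An operator that carries a unitary irreducible representation to isometries is a multiple of an
isometry. -/
theorem exists_inner_map_map {G V : Type*} [Group G] [NormedAddCommGroup V]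
    [InnerProductSpace ℂ V] [FiniteDimensional ℂ V] {π : Representation ℂ G V}
    (hπ : π.IsIrreducible)
    (hinv : ∀ g v w, inner ℂ (π g v) (π g w) = inner ℂ v w)
    (T : V →ₗ[ℂ] V)
    (hT : ∀ g, ∃ u : V →ₗ[ℂ] V, (∀ v w, inner ℂ (u v) (u w) = inner ℂ v w) ∧
      ∀ v, T (π g v) = u (T v)) :
    ∃ r : ℂ, ∀ v w, inner ℂ (T v) (T w) = r * inner ℂ v w := by
  have := nontrivial_of_isIrreducible hπ
  -- `T* T` commutes with `π`, so an eigenspace of it is everything.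
  let B : V →ₗ[ℂ] V := T.adjoint ∘ₗ T
  have hB : ∀ v w, inner ℂ (B v) w = inner ℂ (T v) (T w) := fun v w => by
    simp [B, LinearMap.adjoint_inner_left]
  have hBπ : ∀ g v, B (π g v) = π g (B v) := by
    intro g v
    refine ext_inner_right ℂ fun w => ?_
    obtain ⟨u, hu, hTu⟩ := hT g
    have hw : w = π g (π g⁻¹ w) := by simp [← Module.End.mul_apply, ← map_mul]
    rw [hw, hB, hinv, hB, hTu, hTu, hu]
  obtain ⟨c, hc⟩ := Module.End.exists_eigenvalue B
  obtain ⟨w, hw⟩ := hc.exists_hasEigenvector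
  have htop : Module.End.eigenspace B c = ⊤ := by
    refine eq_top_of_invariant hπ (fun g v hv => ?_) hw.1 hw.2
    rw [Module.End.mem_eigenspace_iff] at hv ⊢
    rw [hBπ, hv, map_smul]
  refine ⟨starRingEnd ℂ c, fun v w => ?_⟩
  have hv : B v = c • v := by
    rw [← Module.End.mem_eigenspace_iff, htop]
    trivial
  rw [← hB, hv, inner_smul_left]

/-! ### Matrices in `GL₂` and fixed vectors of the two tori -/

section Matrices

variable {E : Type*} [Field E]

theorem ext_GL2 {g g' : GL (Fin 2) E} (h00 : g 0 0 = g' 0 0) (h01 : g 0 1 = g' 0 1)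
    (h10 : g 1 0 = g' 1 0) (h11 : g 1 1 = g' 1 1) : g = g' := by
  ext i j
  fin_cases i <;> fin_cases j <;> assumption

theorem mul_apply_GL2 (g g' : GL (Fin 2) E) (i j : Fin 2) :
    (g * g') i j = g i 0 * g' 0 j + g i 1 * g' 1 j := by
  simp [Matrix.mul_apply, Fin.sum_univ_two]

theorem det_ne_zero_GL2 (g : GL (Fin 2) E) : g 0 0 * g 1 1 - g 0 1 * g 1 0 ≠ 0 := by
  rw [← Matrix.det_fin_two]
  exact g.det.ne_zero

@[simp] theorem mirabolic_00 (a : Eˣ) (b : E) : mirabolic a b 0 0 = a := rfl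
@[simp] theorem mirabolic_01 (a : Eˣ) (b : E) : mirabolic a b 0 1 = b := rfl
@[simp] theorem mirabolic_10 (a : Eˣ) (b : E) : mirabolic a b 1 0 = 0 := rfl
@[simp] theorem mirabolic_11 (a : Eˣ) (b : E) : mirabolic a b 1 1 = 1 := rfl
@[simp] theorem antiDiag_00 (b : Eˣ) : antiDiag b 0 0 = 0 := rfl
@[simp] theorem antiDiag_01 (b : Eˣ) : antiDiag b 0 1 = b := rfl
@[simp] theorem antiDiag_10 (b : Eˣ) : antiDiag b 1 0 = 1 := rfl
@[simp] theorem antiDiag_11 (b : Eˣ) : antiDiag b 1 1 = 0 := rfl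

/-- The element of `GL₂` with given entries. -/
def mkGL2 (a b c d : E) (h : a * d - b * c ≠ 0) : GL (Fin 2) E :=
  Matrix.GeneralLinearGroup.mkOfDetNeZero !![a, b; c, d] (by rwa [Matrix.det_fin_two_of])

section
variable (a b c d : E) (h : a * d - b * c ≠ 0)
@[simp] theorem mkGL2_00 : mkGL2 a b c d h 0 0 = a := rfl
@[simp] theorem mkGL2_01 : mkGL2 a b c d h 0 1 = b := rfl
@[simp] theorem mkGL2_10 : mkGL2 a b c d h 1 0 = c := rfl
@[simp] theorem mkGL2_11 : mkGL2 a b c d h 1 1 = d := rfl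
end

theorem toPGL2_eq_of_smul {g g' : GL (Fin 2) E} {r : E} (hr : r ≠ 0)
    (h : ∀ i j, g' i j = r * g i j) : toPGL2 E g = toPGL2 E g' := by
  have h' : g * Matrix.GeneralLinearGroup.scalar (Fin 2) (Units.mk0 r hr) = g' := by
    apply ext_GL2 <;>
      simp [mul_apply_GL2, h, Matrix.GeneralLinearGroup.scalar, mul_comm]
  refine QuotientGroup.eq.2 ?_
  rw [← h', inv_mul_cancel_left, Matrix.GeneralLinearGroup.center_eq_range_scalar]
  exact ⟨_, rfl⟩

variable (E) in
/-- The homomorphism `a ↦ diag(a, 1)`. -/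
def diagHom : Eˣ →* GL (Fin 2) E where
  toFun a := mirabolic a 0
  map_one' := by apply ext_GL2 <;> simp
  map_mul' a b := by apply ext_GL2 <;> simp [mul_apply_GL2]

@[simp] theorem diagHom_00 (a : Eˣ) : diagHom E a 0 0 = a := rfl
@[simp] theorem diagHom_01 (a : Eˣ) : diagHom E a 0 1 = 0 := rfl
@[simp] theorem diagHom_10 (a : Eˣ) : diagHom E a 1 0 = 0 := rfl
@[simp] theorem diagHom_11 (a : Eˣ) : diagHom E a 1 1 = 1 := rfl

theorem diagHom_mul_antiDiag (a b : Eˣ) : diagHom E a * antiDiag b = antiDiag (a * b) := by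
  apply ext_GL2 <;> simp [mul_apply_GL2]

theorem toPGL2_antiDiag_mul_diagHom (a b : Eˣ) :
    toPGL2 E (antiDiag b * diagHom E a) = toPGL2 E (diagHom E a⁻¹ * antiDiag b) := by
  refine toPGL2_eq_of_smul (r := (a : E)⁻¹) (by simp) fun i j => ?_
  fin_cases i <;> fin_cases j <;> simp [mul_apply_GL2, -map_inv]

theorem toPGL2_antiDiag_mul_self (b : Eˣ) : toPGL2 E (antiDiag b * antiDiag b) = 1 := by
  rw [← map_one (toPGL2 E)]
  refine (toPGL2_eq_of_smul (r := (b : E)) (by simp) fun i j => ?_).symm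
  fin_cases i <;> fin_cases j <;> simp [mul_apply_GL2]

theorem exists_toPGL2_diagHom {g : GL (Fin 2) E} (hg : g ∈ splitTorusGL E) :
    ∃ a, toPGL2 E (diagHom E a) = toPGL2 E g := by
  obtain ⟨h1, h2⟩ := hg
  have hdet := det_ne_zero_GL2 g
  rw [h1, zero_mul, sub_zero] at hdet
  have h3 := left_ne_zero_of_mul hdet
  have h4 := right_ne_zero_of_mul hdet
  refine ⟨Units.mk0 (g 0 0 / g 1 1) (div_ne_zero h3 h4), toPGL2_eq_of_smul h4 fun i j => ?_⟩
  fin_cases i <;> fin_cases j <;> simp [h1, h2, mul_div_cancel₀ _ h4]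

theorem diagHom_mem (a : Eˣ) : diagHom E a ∈ splitTorusGL E := by
  constructor <;> simp

theorem mem_fixedVectors_splitTorus {V : Type*} [AddCommGroup V] [Module ℂ V]
    (π : Representation ℂ (PGL2 E) V) (v : V) :
    v ∈ fixedVectors π (splitTorus E) ↔ ∀ a, π ((toPGL2 E).comp (diagHom E) a) v = v := by
  constructor
  · exact fun hv a => hv _ ⟨_, diagHom_mem a, rfl⟩
  · rintro hv _ ⟨g, hg, rfl⟩
    obtain ⟨a, ha⟩ := exists_toPGL2_diagHom hg
    rw [← ha]
    exact hv a

theorem mem_fixedVectors_nonsplitTorus {V : Type*} [AddCommGroup V] [Module ℂ V]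
    (π : Representation ℂ (PGL2 E) V) (α : E) (v : V) :
    v ∈ fixedVectors π (nonsplitTorus α) ↔
      ∀ k, π ((toPGL2 E).comp (nonsplitTorusGL α).subtype k) v = v := by
  constructor
  · exact fun hv a => hv _ ⟨_, a.2, rfl⟩
  · rintro hv _ ⟨g, hg, rfl⟩
    exact hv ⟨g, hg⟩

/-- An invertible `2 × 2` matrix of trace zero is conjugate to a companion matrix. -/
theorem isConj_antiDiag (h2 : (2 : E) ≠ 0) {g : GL (Fin 2) E} (b : Eˣ)
    (htr : g 1 1 = -g 0 0) (hdet : (g.det : E) = -b) : IsConj g (antiDiag b) := by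
  have hdet' : g 0 0 * g 1 1 - g 0 1 * g 1 0 = -b := by
    rw [← hdet, ← Matrix.det_fin_two]; rfl
  -- By Cayley–Hamilton `g² = b`, so in the basis `v, gv` with `v = (p, q)` the matrix becomes
  -- `antiDiag b`. It remains to find a `v` that is not an eigenvector.
  have key : ∀ p q : E, p * (g 1 0 * p + g 1 1 * q) - (g 0 0 * p + g 0 1 * q) * q ≠ 0 →
      IsConj g (antiDiag b) := by
    intro p q hpq
    refine IsConj.symm (isConj_iff.2 ⟨mkGL2 p (g 0 0 * p + g 0 1 * q) q (g 1 0 * p + g 1 1 * q)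
      hpq, ?_⟩)
    rw [mul_inv_eq_iff_eq_mul]
    apply ext_GL2 <;> simp [mul_apply_GL2]
    · linear_combination p * hdet' - (p * g 0 0 + q * g 0 1) * htr
    · linear_combination q * hdet' - (p * g 1 0 + q * g 1 1) * htr
  by_cases hc : g 1 0 = 0
  · by_cases hb : g 0 1 = 0
    · refine key 1 1 ?_
      have h0 : g 0 0 ≠ 0 := by
        intro h0
        have := det_ne_zero_GL2 g
        simp [h0, hb] at this
      intro h
      have : 2 * g 0 0 = 0 := by
        rw [hc, hb, htr] at h
        linear_combination -h
      exact mul_ne_zero h2 h0 this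
    · exact key 0 1 (by simpa using hb)
  · exact key 1 0 (by simpa using hc)

end Matrices

/-! ### Uniqueness of torus-fixed vectors in the principal series -/

section PrincipalSeries

variable {E : Type*} [Field E] {χ : Eˣ →* ℂˣ}

/-- The bottom row of `g k⁻¹` is `(0, 1)`. So a function in `psSpace χ` is determined, up to values
of `χ`, by the bottom row of its argument. -/
theorem eq_mirabolic_mul (g k : GL (Fin 2) E) (h0 : g 1 0 = k 1 0) (h1 : g 1 1 = k 1 1) :
    ∃ a b, g = mirabolic a b * k := by
  have hd : (g * k⁻¹) 1 0 = 0 ∧ (g * k⁻¹) 1 1 = 1 := by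
    have e : ∀ j, (g * k⁻¹) 1 j = (k * k⁻¹) 1 j := fun j => by
      rw [mul_apply_GL2, mul_apply_GL2, h0, h1]
    rw [e, e, mul_inv_cancel]
    simp
  have h00 : (g * k⁻¹) 0 0 ≠ 0 := by
    have := det_ne_zero_GL2 (g * k⁻¹)
    rw [hd.1, hd.2] at this
    simpa using this
  refine ⟨Units.mk0 _ h00, (g * k⁻¹) 0 1, ?_⟩
  rw [← mul_inv_eq_iff_eq_mul]
  apply ext_GL2 <;> simp only [mirabolic_00, mirabolic_01, mirabolic_10, mirabolic_11, hd,
    Units.val_mk0]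

theorem psSpace_apply (f : psSpace χ) (a : Eˣ) (b : E) (g : GL (Fin 2) E) :
    f.1 (toPGL2 E (mirabolic a b * g)) = χ a * f.1 (toPGL2 E g) := by
  rw [map_mul]
  exact f.2 a b _

theorem psSpace_ext {f : psSpace χ} (h : ∀ g, f.1 (toPGL2 E g) = 0) : f = 0 := by
  ext x
  obtain ⟨g, rfl⟩ := QuotientGroup.mk'_surjective _ x
  exact h g

theorem psSpace_mul_right {f : psSpace χ} {s : GL (Fin 2) E}
    (hs : principalSeries χ (toPGL2 E s) f = f) (g : GL (Fin 2) E) :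
    f.1 (toPGL2 E (g * s)) = f.1 (toPGL2 E g) := by
  rw [map_mul]
  exact congrFun (congrArg Subtype.val hs) (toPGL2 E g)

/-- The non-split torus is transitive on bottom rows: `(z, x)` is the bottom row of an element of
the torus, whose determinant `x² - αz²` is nonzero because `α` is not a square. -/
theorem psSpace_eq_zero_of_nonsplitTorus {α : E} (hα : ¬ IsSquare α) {f : psSpace χ}
    (hf : f ∈ fixedVectors (principalSeries χ) (nonsplitTorus α)) (h1 : f.1 1 = 0) : f = 0 := by
  refine psSpace_ext fun g => ?_
  have hN : g 1 1 * g 1 1 - α * g 1 0 * g 1 0 ≠ 0 := by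
    intro h
    by_cases hc : g 1 0 = 0
    · have := det_ne_zero_GL2 g
      simp [hc] at h this
      exact this.2 h
    · refine hα ⟨g 1 1 / g 1 0, ?_⟩
      field_simp
      linear_combination -h
  let k : GL (Fin 2) E := mkGL2 (g 1 1) (α * g 1 0) (g 1 0) (g 1 1) hN
  obtain ⟨a, b, hab⟩ := eq_mirabolic_mul g k rfl rfl
  have hk := psSpace_mul_right (hf _ ⟨k, ⟨rfl, rfl⟩, rfl⟩) 1
  rw [hab, psSpace_apply, ← one_mul k, hk, map_one, h1, mul_zero]

/-- The split torus has three orbits on the projective line of bottom rows. At the two fixed points,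
invariance conflicts with a nontrivial `χ`, so `f` vanishes; the open orbit is represented by the
row `(1, 1)`. -/
theorem psSpace_eq_zero_of_splitTorus (hχ : χ ≠ 1) {f : psSpace χ}
    (hf : f ∈ fixedVectors (principalSeries χ) (splitTorus E))
    (h1 : f.1 (toPGL2 E (mkGL2 1 0 1 1 (by simp))) = 0) : f = 0 := by
  have hfix : ∀ s ∈ splitTorusGL E, ∀ g, f.1 (toPGL2 E (g * s)) = f.1 (toPGL2 E g) :=
    fun s hs => psSpace_mul_right (hf _ ⟨s, hs, rfl⟩)
  obtain ⟨t, ht⟩ : ∃ t, χ t ≠ 1 := by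
    by_contra! h
    exact hχ (MonoidHom.ext h)
  have hzero : ∀ g s : GL (Fin 2) E, s ∈ splitTorusGL E → ∀ b,
      g * s = mirabolic t b * g → f.1 (toPGL2 E g) = 0 := by
    intro g s hs b h
    have := hfix s hs g
    rw [h, psSpace_apply] at this
    by_contra h0
    exact ht (Units.ext (mul_right_cancel₀ h0 (this.trans (one_mul _).symm)))
  refine psSpace_ext fun g => ?_
  by_cases hc : g 1 0 = 0
  · have hd : g 1 1 ≠ 0 := fun h => det_ne_zero_GL2 g (by simp [hc, h])
    refine hzero g (diagHom E t) (diagHom_mem t) (g 0 1 * (1 - t) / g 1 1) ?_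
    apply ext_GL2 <;> simp [mul_apply_GL2, hc]
    · ring
    · field_simp
      ring
  by_cases hd : g 1 1 = 0
  · refine hzero g (mkGL2 1 0 0 t (by simp)) ⟨rfl, rfl⟩ (g 0 0 * (1 - t) / g 1 0) ?_
    apply ext_GL2 <;> simp [mul_apply_GL2, hd]
    · field_simp
      ring
    · ring
  · let s : GL (Fin 2) E := mkGL2 (g 1 0) 0 0 (g 1 1) (by simp [hc, hd])
    obtain ⟨a, b, hab⟩ := eq_mirabolic_mul g (mkGL2 1 0 1 1 (by simp) * s)
      (by simp [mul_apply_GL2, s]) (by simp [mul_apply_GL2, s])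
    rw [hab, psSpace_apply, hfix s ⟨rfl, rfl⟩, h1, mul_zero]

/-- If the space of fixed vectors embeds into `ℂ` by a linear functional, it is spanned by any of
its nonzero elements. -/
theorem eq_span_singleton_of_functional {V : Type*} [AddCommGroup V] [Module ℂ V]
    {U : Submodule ℂ V} (L : V →ₗ[ℂ] ℂ) (hL : ∀ u ∈ U, L u = 0 → u = 0) {v : V} (hv : v ∈ U)
    (hv0 : v ≠ 0) : U = ℂ ∙ v := by
  have hLv : L v ≠ 0 := fun h => hv0 (hL v hv h)
  refine le_antisymm (fun u hu => ?_) ((Submodule.span_singleton_le_iff_mem _ _).2 hv)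
  refine Submodule.mem_span_singleton.2 ⟨L u / L v, ?_⟩
  have := hL (u - (L u / L v) • v) (U.sub_mem hu (U.smul_mem _ hv)) (by simp [hLv])
  exact (sub_eq_zero.1 this).symm

variable {V : Type*} [AddCommGroup V] [Module ℂ V] {π : Representation ℂ (PGL2 E) V}

theorem equiv_mem_fixedVectors (e : π.Equiv (principalSeries χ)) {S : Subgroup (PGL2 E)} {v : V}
    (hv : v ∈ fixedVectors π S) : e v ∈ fixedVectors (principalSeries χ) S := by
  intro s hs
  have h := Representation.IntertwiningMap.isIntertwining _ _ e.toIntertwiningMap s v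
  rw [hv s hs] at h
  exact h.symm

/-- The functional on a model of the principal series given by evaluation at a point. -/
def evalAt (e : π.Equiv (principalSeries χ)) (x : PGL2 E) : V →ₗ[ℂ] ℂ :=
  LinearMap.proj x ∘ₗ (psSpace χ).subtype ∘ₗ e.toLinearEquiv.toLinearMap

theorem eq_zero_of_equiv_eq_zero (e : π.Equiv (principalSeries χ)) {v : V} (h : e v = 0) :
    v = 0 :=
  e.toLinearEquiv.map_eq_zero_iff.1 h

theorem fixedVectors_nonsplitTorus_eq_span {α : E} (hα : ¬ IsSquare α)
    (e : π.Equiv (principalSeries χ)) {v : V} (hv : v ∈ fixedVectors π (nonsplitTorus α))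
    (hv0 : v ≠ 0) : fixedVectors π (nonsplitTorus α) = ℂ ∙ v :=
  eq_span_singleton_of_functional (evalAt e 1) (fun _ hu h => eq_zero_of_equiv_eq_zero e
    (psSpace_eq_zero_of_nonsplitTorus hα (equiv_mem_fixedVectors e hu) h)) hv hv0

/-- The constants form an invariant line in `Ps(1, 1)`, hence fill it if the representation is
irreducible. Evaluation at a point therefore stays injective when `χ = 1`. -/
theorem psSpace_one_eq_span (hπ : π.IsIrreducible) (e : π.Equiv (principalSeries (1 : Eˣ →* ℂˣ)))
    (f : psSpace (1 : Eˣ →* ℂˣ)) (x y : PGL2 E) : f.1 x = f.1 y := by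
  let c : psSpace (1 : Eˣ →* ℂˣ) := ⟨fun _ => 1, fun a b g => by simp⟩
  have hc : ∀ g, principalSeries 1 g c = c := fun g => rfl
  have hc0 : c ≠ 0 := fun h => one_ne_zero (congrFun (congrArg Subtype.val h) 1)
  let v := e.toLinearEquiv.symm c
  have hev : e v = c := e.toLinearEquiv.apply_symm_apply c
  have hv0 : v ≠ 0 := fun h => hc0 (by rw [← hev, h]; exact e.toLinearEquiv.map_zero)
  have hfix : ∀ g, π g v = v := by
    intro g
    refine e.toLinearEquiv.injective ?_
    refine (Representation.IntertwiningMap.isIntertwining _ _ e.toIntertwiningMap g v).trans ?_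
    change principalSeries 1 g (e v) = e v
    rw [hev, hc]
  have htop := eq_top_of_invariant hπ (U := ℂ ∙ v) (fun g w hw => by
    obtain ⟨a, rfl⟩ := Submodule.mem_span_singleton.1 hw
    rw [map_smul, hfix]
    exact hw) (Submodule.mem_span_singleton_self v) hv0
  have hf : e.toLinearEquiv.symm f ∈ ℂ ∙ v := by rw [htop]; trivial
  obtain ⟨a, ha⟩ := Submodule.mem_span_singleton.1 hf
  have : f = a • c := by
    rw [← e.toLinearEquiv.apply_symm_apply f, ← ha, map_smul]
    exact congrArg (a • ·) hev
  rw [this]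
  rfl

theorem fixedVectors_splitTorus_eq_span (hπ : π.IsIrreducible)
    (e : π.Equiv (principalSeries χ)) {v : V} (hv : v ∈ fixedVectors π (splitTorus E))
    (hv0 : v ≠ 0) : fixedVectors π (splitTorus E) = ℂ ∙ v := by
  refine eq_span_singleton_of_functional
    (evalAt e (toPGL2 E (mkGL2 1 0 1 1 (by simp)))) (fun u hu h => ?_) hv hv0
  refine eq_zero_of_equiv_eq_zero e ?_
  by_cases hχ : χ = 1
  · subst hχ
    exact psSpace_ext fun g => (psSpace_one_eq_span hπ e _ _ _).trans h
  · exact psSpace_eq_zero_of_splitTorus hχ (equiv_mem_fixedVectors e hu) h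

theorem finiteDimensional_of_equiv [Finite E] (e : π.Equiv (principalSeries χ)) :
    FiniteDimensional ℂ V :=
  Module.Finite.equiv e.toLinearEquiv.symm

end PrincipalSeries

/-! ### The transpose argument bounding `τ^H` -/

section SplitTorusMultiplicity

open scoped Classical

variable {F : Type*} [Field F]

/-- The transpose of an element of `GL₂`. -/
def transposeGL2 (g : GL (Fin 2) F) : GL (Fin 2) F :=
  mkGL2 (g 0 0) (g 1 0) (g 0 1) (g 1 1) (by
    rw [mul_comm (g 1 0)]
    exact det_ne_zero_GL2 g)

theorem transposeGL2_mul_diagHom_mul (x y : GL (Fin 2) F) (a : Fˣ) :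
    transposeGL2 (x * diagHom F a * y) = transposeGL2 y * diagHom F a * transposeGL2 x := by
  apply ext_GL2 <;> simp [transposeGL2, mul_apply_GL2] <;> ring

theorem transposeGL2_eq (g : GL (Fin 2) F) (h01 : g 0 1 ≠ 0) (h10 : g 1 0 ≠ 0) :
    ∃ a b, transposeGL2 g = diagHom F a * g * diagHom F b := by
  refine ⟨Units.mk0 (g 1 0 / g 0 1) (div_ne_zero h10 h01),
    Units.mk0 (g 0 1 / g 1 0) (div_ne_zero h01 h10), ?_⟩
  apply ext_GL2 <;> simp [transposeGL2, mul_apply_GL2] <;> field_simp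

/-- Covers matrices with a zero off the diagonal, whose transpose need not lie in the same double
coset of the torus. Conjugation by `antiDiag β` is harmless once it acts by a sign on fixed vectors.
-/
theorem toPGL2_transposeGL2_eq (β : Fˣ) (g : GL (Fin 2) F) (h00 : g 0 0 ≠ 0) (h11 : g 1 1 ≠ 0) :
    ∃ a b, toPGL2 F (transposeGL2 g) =
      toPGL2 F (diagHom F a * antiDiag β * g * antiDiag β * diagHom F b) := by
  refine ⟨Units.mk0 _ h00 * (Units.mk0 _ h11)⁻¹ * β⁻¹, Units.mk0 _ h00 * (Units.mk0 _ h11)⁻¹ * β,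
    ?_⟩
  refine toPGL2_eq_of_smul (r := β * g 0 0 / g 1 1) ?_ fun i j => ?_
  · exact div_ne_zero (mul_ne_zero β.ne_zero h00) h11
  · fin_cases i <;> fin_cases j <;>
      simp [transposeGL2, mul_apply_GL2, -map_mul, -map_inv] <;> field_simp

variable [Fintype F] {W : Type*} [AddCommGroup W] [Module ℂ W]

/-- The projection to the vectors fixed by the split torus. -/
def splitProj (τ : Representation ℂ (PGL2 F) W) : W →ₗ[ℂ] W :=
  averaging τ ((toPGL2 F).comp (diagHom F))

theorem isProj_splitProj (τ : Representation ℂ (PGL2 F) W) :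
    LinearMap.IsProj (fixedVectors τ (splitTorus F)) (splitProj τ) :=
  isProj_averaging τ _ (mem_fixedVectors_splitTorus τ)

theorem splitProj_antiDiag (τ : Representation ℂ (PGL2 F) W) (β : Fˣ) (w : W) :
    splitProj τ (τ (toPGL2 F (antiDiag β)) w) = τ (toPGL2 F (antiDiag β)) (splitProj τ w) := by
  rw [splitProj, averaging_apply, averaging_apply, map_mean]
  refine Eq.trans ?_ (mean_comp_equiv (Equiv.inv Fˣ) _)
  congr 1
  ext a
  simp only [← Module.End.mul_apply, ← map_mul, MonoidHom.comp_apply, Equiv.inv_apply,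
    toPGL2_antiDiag_mul_diagHom, inv_inv]

/-- If `k₀` acts by a scalar on the vectors fixed by the split torus, these form at most a line. -/
theorem finrank_splitTorus_le_one [FiniteDimensional ℂ W] {τ : Representation ℂ (PGL2 F) W}
    (hτ : τ.IsIrreducible) (β : Fˣ) {s : ℂ} (hs : s * s = 1)
    (h : ∀ u ∈ fixedVectors τ (splitTorus F), τ (toPGL2 F (antiDiag β)) u = s • u) :
    Module.finrank ℂ (fixedVectors τ (splitTorus F)) ≤ 1 := by
  have hP := isProj_splitProj τ
  have hmul : ∀ (x y : GL (Fin 2) F) (v : W),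
      τ (toPGL2 F (x * y)) v = τ (toPGL2 F x) (τ (toPGL2 F y) v) := fun x y v => by
    rw [map_mul, map_mul, Module.End.mul_apply]
  have hr : ∀ a v, τ (toPGL2 F (diagHom F a)) (splitProj τ v) = splitProj τ v := fun a v =>
    congr($(map_comp_averaging τ ((toPGL2 F).comp (diagHom F)) a) v)
  have hl : ∀ a v, splitProj τ (τ (toPGL2 F (diagHom F a)) v) = splitProj τ v := fun a v =>
    congr($(averaging_comp_map τ ((toPGL2 F).comp (diagHom F)) a) v)
  have hkr : ∀ v, τ (toPGL2 F (antiDiag β)) (splitProj τ v) = s • splitProj τ v := fun v =>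
    h _ (hP.map_mem v)
  have hT : ∀ g v, splitProj τ (τ (toPGL2 F (transposeGL2 g)) (splitProj τ v)) =
      splitProj τ (τ (toPGL2 F g) (splitProj τ v)) := by
    intro g v
    -- If a diagonal entry vanishes, invertibility makes both off-diagonal entries nonzero.
    -- Otherwise `antiDiag β` enters twice and contributes `s * s = 1`.
    by_cases h01 : g 0 0 * g 1 1 = 0
    · have hdet := det_ne_zero_GL2 g
      rw [h01, zero_sub, neg_ne_zero] at hdet
      obtain ⟨a, b, hab⟩ := transposeGL2_eq g (left_ne_zero_of_mul hdet)
        (right_ne_zero_of_mul hdet)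
      rw [hab, hmul, hr, hmul, hl]
    · obtain ⟨a, b, hab⟩ := toPGL2_transposeGL2_eq β g (left_ne_zero_of_mul h01)
        (right_ne_zero_of_mul h01)
      rw [hab, hmul, hr, hmul, hkr, map_smul, map_smul, hmul, hmul, hl, splitProj_antiDiag, hkr,
        smul_smul, hs, one_smul]
  have hmean : ∀ x y v, splitProj τ (τ (toPGL2 F x) (splitProj τ (τ (toPGL2 F y) v))) =
      mean Fˣ fun a => splitProj τ (τ (toPGL2 F (x * diagHom F a * y)) v) := by
    intro x y v
    have e : splitProj τ (τ (toPGL2 F y) v) =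
        mean Fˣ fun a => τ (toPGL2 F (diagHom F a)) (τ (toPGL2 F y) v) := averaging_apply τ _ _
    rw [e, map_mean, map_mean]
    simp only [hmul]
  refine finrank_le_one_of_commute hτ hP fun g k v hv => ?_
  obtain ⟨x, rfl⟩ := QuotientGroup.mk'_surjective _ g
  obtain ⟨y, rfl⟩ := QuotientGroup.mk'_surjective _ k
  rw [← hP.map_id v hv]
  -- Transposition reverses products and fixes the torus, so it swaps the order of the compressions
  -- while leaving each of them unchanged.
  calc _ = splitProj τ (τ (toPGL2 F (transposeGL2 y))
        (splitProj τ (τ (toPGL2 F (transposeGL2 x)) (splitProj τ v)))) := by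
        rw [hmean, hmean]
        exact congrArg (mean Fˣ) (funext fun a => by rw [← hT, transposeGL2_mul_diagHom_mul])
    _ = _ := by rw [hT, hT]

end SplitTorusMultiplicity

theorem det_eq_GL2 {E : Type*} [Field E] (g : GL (Fin 2) E) : (g.det : E) = g 0 0 * g 1 1 - g 0 1 * g 1 0 :=
  Matrix.det_fin_two _

/-! ### Shintani norms on the two tori -/

section Norm

theorem two_ne_zero_of_ringChar {F E : Type*} [Field F] [Field E] [Algebra F E]
    (hp : ringChar F ≠ 2) : (2 : E) ≠ 0 := by
  have h : (2 : F) ≠ 0 := Ring.two_ne_zero hp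
  have := (map_ne_zero (algebraMap F E)).2 h
  rwa [map_ofNat] at this

/-- The norm on units. -/
def unitsNorm (F E : Type*) [Field F] [Field E] [Algebra F E] : Eˣ →* Fˣ :=
  Units.map (Algebra.norm F)

theorem unitsNorm_surjective (F E : Type*) [Field F] [Field E] [Finite E] [Algebra F E] :
    Function.Surjective (unitsNorm F E) :=
  FiniteField.unitsMap_norm_surjective F E

variable {F E : Type*} [Field F] [Fintype F] [Field E] [Algebra F E]

theorem frob_iterate_apply (n : ℕ) (g : GL (Fin 2) E) (i j : Fin 2) :
    ((frob F E)^[n] g) i j = g i j ^ Fintype.card F ^ n := by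
  induction n with
  | zero => simp
  | succ n ih =>
    rw [Function.iterate_succ_apply', pow_succ, pow_mul, ← ih]
    rfl

theorem frob_apply (g : GL (Fin 2) E) (i j : Fin 2) :
    frob F E g i j = g i j ^ Fintype.card F := rfl

variable (F) in
/-- The partial norm `g g^σ ⋯ g^{σ^{n-1}}`. -/
def partialNorm (n : ℕ) (g : GL (Fin 2) E) : GL (Fin 2) E :=
  ((List.range n).map fun i => (frob F E)^[i] g).prod

theorem partialNorm_zero (g : GL (Fin 2) E) : partialNorm F 0 g = 1 := rfl

theorem partialNorm_succ (n : ℕ) (g : GL (Fin 2) E) :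
    partialNorm F (n + 1) g = partialNorm F n g * (frob F E)^[n] g := by
  simp [partialNorm, List.range_succ]

/-- The hypotheses describe the coset of the non-split torus by `diag(γ,1)⁻¹`. The relation `Γ² α =
α^(q^n)` says that `diag(Γ,1)` conjugates the torus to its `n`-th Frobenius twist, so the shape
survives each further factor. -/
theorem partialNorm_entries {α γ : E} (hγ : γ ^ 2 * α = α ^ Fintype.card F) {g : GL (Fin 2) E}
    (h0 : γ * g 0 0 = g 1 1) (h1 : g 0 1 = α * γ * g 1 0) (n : ℕ) {Γ : E}
    (hΓ : Γ = ∏ i ∈ Finset.range n, γ ^ Fintype.card F ^ i) :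
    Γ ^ 2 * α = α ^ Fintype.card F ^ n ∧
      Γ * partialNorm F n g 0 0 = partialNorm F n g 1 1 ∧
      partialNorm F n g 0 1 = α * Γ * partialNorm F n g 1 0 := by
  subst hΓ
  induction n with
  | zero => simp [partialNorm_zero]
  | succ n ih =>
    obtain ⟨i1, i2, i3⟩ := ih
    have e0 : γ ^ Fintype.card F ^ n * ((frob F E)^[n] g) 0 0 = ((frob F E)^[n] g) 1 1 := by
      rw [frob_iterate_apply, frob_iterate_apply, ← h0, mul_pow]
    have e1 : ((frob F E)^[n] g) 0 1 =
        α ^ Fintype.card F ^ n * γ ^ Fintype.card F ^ n * ((frob F E)^[n] g) 1 0 := by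
      rw [frob_iterate_apply, frob_iterate_apply, h1, mul_pow, mul_pow]
    have e2 : (γ ^ Fintype.card F ^ n) ^ 2 * α ^ Fintype.card F ^ n =
        α ^ Fintype.card F ^ (n + 1) := by
      rw [pow_succ (Fintype.card F), mul_comm (Fintype.card F ^ n), pow_mul, ← hγ, mul_pow,
        ← pow_mul, ← pow_mul, mul_comm 2]
    rw [← i1] at e1 e2
    rw [partialNorm_succ, Finset.prod_range_succ]
    simp only [mul_apply_GL2]
    rw [e1, ← e0, i3, ← i2]
    refine ⟨?_, ?_, ?_⟩
    · rw [← e2]; ring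
    · ring
    · ring

variable [Fintype E]

theorem algebraMap_norm_eq_prod (x : E) :
    algebraMap F E (Algebra.norm F x) =
      ∏ i ∈ Finset.range (Module.finrank F E), x ^ Fintype.card F ^ i := by
  rw [FiniteField.algebraMap_norm_eq_prod_pow, Nat.card_eq_fintype_card]

theorem det_shintaniNorm (g : GL (Fin 2) E) :
    ((shintaniNorm F E g).det : E) = algebraMap F E (Algebra.norm F (g.det : E)) := by
  have h1 : ∀ i, (((frob F E)^[i] g).det : E) = (g.det : E) ^ Fintype.card F ^ i := by
    intro i
    induction i with
    | zero => simp
    | succ i ih =>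
      rw [Function.iterate_succ_apply', pow_succ, pow_mul, ← ih, det_eq_GL2, det_eq_GL2]
      simp only [frob_apply]
      have := map_sub (FiniteField.frobeniusAlgHom F E)
      simp only [FiniteField.coe_frobeniusAlgHom] at this
      rw [this, mul_pow, mul_pow]
  have h2 : ∀ n, ((partialNorm F n g).det : E) =
      ∏ i ∈ Finset.range n, (g.det : E) ^ Fintype.card F ^ i := by
    intro n
    induction n with
    | zero => simp [partialNorm_zero]
    | succ n ih => rw [partialNorm_succ, map_mul, Units.val_mul, ih, h1, Finset.prod_range_succ]
  rw [algebraMap_norm_eq_prod, ← h2]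
  rfl

theorem shintaniNorm_diagHom (a : Eˣ) :
    shintaniNorm F E (diagHom E a) =
      Matrix.GeneralLinearGroup.map (algebraMap F E) (diagHom F (unitsNorm F E a)) := by
  have h1 : ∀ i, (frob F E)^[i] (diagHom E a) = diagHom E (a ^ Fintype.card F ^ i) := by
    intro i
    apply ext_GL2 <;> rw [frob_iterate_apply] <;> simp [-map_pow]
  have h2 : ∀ n, partialNorm F n (diagHom E a) =
      diagHom E (∏ i ∈ Finset.range n, a ^ Fintype.card F ^ i) := by
    intro n
    induction n with
    | zero => simp [partialNorm_zero]
    | succ n ih => rw [partialNorm_succ, ih, h1, Finset.prod_range_succ, map_mul]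
  refine (h2 _).trans ?_
  apply ext_GL2 <;> simp [-map_prod, unitsNorm, algebraMap_norm_eq_prod]

/-- For a non-square `α`, the element `γ = α^{(q-1)/2}` satisfies `γ² α = α^σ` and has norm `-1`. -/
theorem exists_norm_eq_neg_one (hp : ringChar F ≠ 2) {α : E} (hα : ¬ IsSquare α) :
    ∃ γ : Eˣ, (γ : E) ^ 2 * α = α ^ Fintype.card F ∧
      ∏ i ∈ Finset.range (Module.finrank F E), (γ : E) ^ Fintype.card F ^ i = -1 := by
  have hpE : ringChar E ≠ 2 := by
    rwa [← Algebra.ringChar_eq F E]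
  have hα0 : α ≠ 0 := fun h => hα (h ▸ IsSquare.zero)
  have hq := FiniteField.odd_card_of_char_ne_two hp
  have hQ := FiniteField.odd_card_of_char_ne_two hpE
  refine ⟨Units.mk0 (α ^ (Fintype.card F / 2)) (pow_ne_zero _ hα0), ?_, ?_⟩
  · rw [Units.val_mk0, ← pow_mul, ← pow_succ]
    congr 1
    omega
  -- Euler's criterion: the exponents add up to `(|F| - 1)/2 * (1 + q + ⋯ + q^(f-1)) = (|E| - 1)/2`,
  -- with `q = |F|` and `f = [E : F]`.
  · have h1 : α ^ (Fintype.card E / 2) = -1 :=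
      (FiniteField.pow_dichotomy hpE hα0).resolve_left
        fun h => hα ((FiniteField.isSquare_iff hpE hα0).2 h)
    rw [Units.val_mk0, Finset.prod_pow_eq_pow_sum, ← pow_mul, ← h1]
    congr 1
    have h3 := geom_sum_mul_of_one_le (x := Fintype.card F) Fintype.card_pos
      (Module.finrank F E)
    rw [← Module.card_eq_pow_finrank] at h3
    have h4 : Fintype.card F - 1 = 2 * (Fintype.card F / 2) := by omega
    rw [h4] at h3
    have h5 : 2 * (Fintype.card F / 2 *
        ∑ i ∈ Finset.range (Module.finrank F E), Fintype.card F ^ i) = Fintype.card E - 1 := by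
      rw [← h3]; ring
    omega

/-- The determinant on the non-split torus. -/
def detNonsplit (α : E) : nonsplitTorusGL α →* Eˣ :=
  Matrix.GeneralLinearGroup.det.comp (nonsplitTorusGL α).subtype

theorem detNonsplit_surjective (hp : ringChar E ≠ 2) {α : E} (hα : α ≠ 0) :
    Function.Surjective (detNonsplit α) := by
  intro b
  obtain ⟨x, z, h⟩ := FiniteField.exists_root_sum_quadratic (R := E)
    (f := Polynomial.X ^ 2 - Polynomial.C (b : E)) (g := Polynomial.C (-α) * Polynomial.X ^ 2)
    (Polynomial.degree_X_pow_sub_C (by norm_num) _)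
    (Polynomial.degree_C_mul_X_pow 2 (neg_ne_zero.2 hα))
    (FiniteField.odd_card_of_char_ne_two hp)
  simp only [Polynomial.eval_sub, Polynomial.eval_pow, Polynomial.eval_X, Polynomial.eval_C,
    Polynomial.eval_mul] at h
  have hb : x * x - α * z * z = b := by linear_combination h
  refine ⟨⟨mkGL2 x (α * z) z x (hb ▸ b.ne_zero), rfl, rfl⟩, Units.ext ?_⟩
  exact (det_eq_GL2 _).trans hb

/-- The accumulated factor `Γ` is the norm `-1`, which forces trace zero. The determinant is `-N(det
k)`, the sign again coming from `γ`. -/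
theorem isConj_shintaniNorm_nonsplit (h2 : (2 : E) ≠ 0) {α : E} {γ : Eˣ}
    (hγ : (γ : E) ^ 2 * α = α ^ Fintype.card F)
    (hN : ∏ i ∈ Finset.range (Module.finrank F E), (γ : E) ^ Fintype.card F ^ i = -1)
    (k : nonsplitTorusGL α) :
    IsConj (shintaniNorm F E (k * (diagHom E γ)⁻¹)) (Matrix.GeneralLinearGroup.map (algebraMap F E)
      (antiDiag (unitsNorm F E (detNonsplit α k)))) := by
  have hmap : Matrix.GeneralLinearGroup.map (algebraMap F E)
      (antiDiag (unitsNorm F E (detNonsplit α k))) =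
      antiDiag (Units.map (algebraMap F E : F →* E) (unitsNorm F E (detNonsplit α k))) := by
    apply ext_GL2 <;> simp
  rw [hmap]
  obtain ⟨k, hk0, hk1⟩ := k
  have h := partialNorm_entries (F := F) (g := k * (diagHom E γ)⁻¹) hγ
    (by rw [← map_inv]; simp [mul_apply_GL2, -map_inv, hk0]; field_simp)
    (by rw [← map_inv]; simp [mul_apply_GL2, -map_inv, hk1]; field_simp) _ hN.symm
  refine isConj_antiDiag h2 _ (by rw [← neg_one_mul]; exact h.2.1.symm) ?_
  rw [det_shintaniNorm]
  have hγdet : (diagHom E γ).det = γ := Units.ext (by rw [det_eq_GL2]; simp)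
  have hγN : Algebra.norm F ((γ⁻¹ : Eˣ) : E) = -1 := by
    apply (algebraMap F E).injective
    have : algebraMap F E (Algebra.norm F (γ : E)) = -1 := (algebraMap_norm_eq_prod _).trans hN
    have h' : Algebra.norm F ((γ⁻¹ : Eˣ) : E) * Algebra.norm F (γ : E) = 1 := by
      rw [← map_mul, Units.inv_mul, map_one]
    have := congrArg (algebraMap F E) h'
    rw [map_mul, ‹algebraMap F E (Algebra.norm F (γ : E)) = -1›, map_one] at this
    rw [map_neg, map_one]
    linear_combination -this
  rw [map_mul, map_inv, hγdet, Units.val_mul, map_mul, hγN]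
  simp [unitsNorm, detNonsplit]

end Norm

/-! ### The action of `T` on the invariant vectors -/

open scoped Classical

/-- Multiplying `antiDiag β` by `diag(a,1)` gives `antiDiag (a * β)`, which runs over all `antiDiag
b`. -/
theorem epsilonSign_eq_mean {F W : Type*} [Field F] [Fintype F] [AddCommGroup W] [Module ℂ W]
    [FiniteDimensional ℂ W] (τ : Representation ℂ (PGL2 F) W) (β : Fˣ) :
    epsilonSign τ β = mean Fˣ fun b => LinearMap.trace ℂ W (τ (toPGL2 F (antiDiag b))) := by
  rw [epsilonSign, ← trace_proj_comp (isProj_splitProj τ), splitProj, trace_averaging_comp]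
  refine Eq.trans ?_ (mean_comp_equiv (Equiv.mulRight β) _)
  refine congrArg (mean Fˣ) (funext fun a => ?_)
  rw [Equiv.coe_mulRight, ← diagHom_mul_antiDiag, map_mul, map_mul]
  rfl

theorem finrank_splitTorus_eq_mean {F W : Type*} [Field F] [Fintype F] [AddCommGroup W]
    [Module ℂ W] [FiniteDimensional ℂ W] (τ : Representation ℂ (PGL2 F) W) :
    (Module.finrank ℂ (fixedVectors τ (splitTorus F)) : ℂ) =
      mean Fˣ fun b => LinearMap.trace ℂ W (τ (toPGL2 F (diagHom F b))) := by
  have h := trace_averaging_comp τ ((toPGL2 F).comp (diagHom F)) LinearMap.id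
  rw [LinearMap.comp_id] at h
  rw [← (isProj_splitProj τ).trace]
  exact h

section

variable {F E : Type*} [Field F] [Fintype F] [Field E] [Fintype E] [Algebra F E]
  {V : Type*} [AddCommGroup V] [Module ℂ V] [FiniteDimensional ℂ V]
  {π : Representation ℂ (PGL2 E) V}
  {W : Type*} [AddCommGroup W] [Module ℂ W] [FiniteDimensional ℂ W]
  {τ : Representation ℂ (PGL2 F) W} {T : V →ₗ[ℂ] V}

theorem map_splitTorus_vector
    (hT : ∀ g : GL (Fin 2) E, T ∘ₗ π (toPGL2 E g) = π (toPGL2 E (frob F E g)) ∘ₗ T)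
    (htr : ∀ (g : GL (Fin 2) E) (x : GL (Fin 2) F),
      IsConj (shintaniNorm F E g) (Matrix.GeneralLinearGroup.map (algebraMap F E) x) →
        LinearMap.trace ℂ V (π (toPGL2 E g) ∘ₗ T) = LinearMap.trace ℂ W (τ (toPGL2 F x)))
    {v : V} (hv0 : v ≠ 0) (hv : v ∈ fixedVectors π (splitTorus E))
    (hspan : fixedVectors π (splitTorus E) = ℂ ∙ v) :
    T v = (Module.finrank ℂ (fixedVectors τ (splitTorus F)) : ℂ) • v := by
  have hmem : T v ∈ fixedVectors π (splitTorus E) := by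
    rw [mem_fixedVectors_splitTorus]
    intro a
    obtain ⟨b, hb⟩ : ∃ b : E, b ^ Fintype.card F = a :=
      Finite.injective_iff_surjective.1 (FiniteField.frobeniusAlgHom F E).injective a
    have hb0 : b ≠ 0 := by
      rintro rfl
      rw [zero_pow Fintype.card_ne_zero] at hb
      exact a.ne_zero hb.symm
    have hfrob : diagHom E a = frob F E (diagHom E (Units.mk0 b hb0)) := by
      apply ext_GL2 <;> rw [frob_apply] <;> simp [hb]
    have := congr($(hT (diagHom E (Units.mk0 b hb0))) v)
    rw [← hfrob, LinearMap.comp_apply, LinearMap.comp_apply, hv _ ⟨_, diagHom_mem _, rfl⟩] at this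
    exact this.symm
  rw [hspan] at hmem
  obtain ⟨c, hc⟩ := Submodule.mem_span_singleton.1 hmem
  have h := trace_proj_comp_of_eigenvector hv0 (hspan ▸ isProj_splitProj π) T hc.symm
  rw [splitProj, trace_averaging_comp] at h
  rw [← hc, ← h, finrank_splitTorus_eq_mean, ← mean_comp_of_surjective (unitsNorm F E)
    (unitsNorm_surjective F E)]
  congr 2
  ext a
  exact htr _ _ (by rw [shintaniNorm_diagHom])

theorem map_nonsplitTorus_vector (hp : ringChar F ≠ 2)
    (hT : ∀ g : GL (Fin 2) E, T ∘ₗ π (toPGL2 E g) = π (toPGL2 E (frob F E g)) ∘ₗ T)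
    (htr : ∀ (g : GL (Fin 2) E) (x : GL (Fin 2) F),
      IsConj (shintaniNorm F E g) (Matrix.GeneralLinearGroup.map (algebraMap F E) x) →
        LinearMap.trace ℂ V (π (toPGL2 E g) ∘ₗ T) = LinearMap.trace ℂ W (τ (toPGL2 F x)))
    {α : E} (hα : ¬ IsSquare α) (β : Fˣ)
    {v : V} (hv0 : v ≠ 0) (hv : v ∈ fixedVectors π (nonsplitTorus α))
    (hspan : fixedVectors π (nonsplitTorus α) = ℂ ∙ v) :
    ∃ γ : Eˣ, T v = epsilonSign τ β • π (toPGL2 E (diagHom E γ)) v := by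
  obtain ⟨γ, hγ, hN⟩ := exists_norm_eq_neg_one hp hα
  have hpE : ringChar E ≠ 2 := by rwa [← Algebra.ringChar_eq F E]
  have hα0 : α ≠ 0 := fun h => hα (h ▸ IsSquare.zero)
  refine ⟨γ, ?_⟩
  have hmul : ∀ (x y : GL (Fin 2) E) (w : V),
      π (toPGL2 E (x * y)) w = π (toPGL2 E x) (π (toPGL2 E y) w) := fun x y w => by
    rw [map_mul, map_mul, Module.End.mul_apply]
  -- `T` sends vectors fixed by the torus to vectors fixed by its Frobenius twist; undoing the
  -- conjugation by `diag(γ,1)` returns to the original torus.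
  let A : V →ₗ[ℂ] V := π (toPGL2 E (diagHom E γ)⁻¹) ∘ₗ T
  have hmem : A v ∈ fixedVectors π (nonsplitTorus α) := by
    rintro _ ⟨k, ⟨hk0, hk1⟩, rfl⟩
    have hsurj : ∀ a : E, ∃ b : E, b ^ Fintype.card F = a :=
      Finite.injective_iff_surjective.1 (FiniteField.frobeniusAlgHom F E).injective
    obtain ⟨x, hx⟩ := hsurj (k 0 0)
    obtain ⟨z, hz⟩ := hsurj (k 1 0 / γ)
    -- The Frobenius image of this quantity is the determinant of `k`.
    have hxz : x * x - α * z * z ≠ 0 := by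
      intro h
      have hdet := det_ne_zero_GL2 k
      have h1 : (x * x) ^ Fintype.card F = (α * z * z) ^ Fintype.card F := by
        rw [sub_eq_zero.1 h]
      rw [mul_pow, mul_pow, mul_pow, hx, hz, ← hγ] at h1
      field_simp at h1
      rw [← hk0, hk1] at hdet
      apply hdet
      linear_combination h1
    let k' : GL (Fin 2) E := mkGL2 x (α * z) z x hxz
    have hfrob : k * (diagHom E γ)⁻¹ = (diagHom E γ)⁻¹ * frob F E k' := by
      rw [mul_inv_eq_iff_eq_mul, mul_assoc, eq_inv_mul_iff_mul_eq]
      apply ext_GL2 <;> simp [mul_apply_GL2, frob_apply, k', mul_pow, hx, hz, ← hγ, hk0, hk1]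
      · ring
      · field_simp
    have h := congr($(hT k') v)
    rw [LinearMap.comp_apply, LinearMap.comp_apply, hv _ ⟨k', ⟨rfl, rfl⟩, rfl⟩] at h
    rw [LinearMap.comp_apply, ← hmul, hfrob, hmul, ← h]
  rw [hspan] at hmem
  obtain ⟨c, hc⟩ := Submodule.mem_span_singleton.1 hmem
  have hP := isProj_averaging π ((toPGL2 E).comp (nonsplitTorusGL α).subtype)
    (mem_fixedVectors_nonsplitTorus π α)
  have h := trace_proj_comp_of_eigenvector hv0 (hspan ▸ hP) A hc.symm
  rw [trace_averaging_comp] at h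
  have hcε : c = epsilonSign τ β := by
    rw [← h, epsilonSign_eq_mean, ← mean_comp_of_surjective
      ((unitsNorm F E).comp (detNonsplit α))
      ((unitsNorm_surjective F E).comp (detNonsplit_surjective hpE hα0))]
    congr 1
    ext k
    rw [← LinearMap.comp_assoc]
    refine Eq.trans ?_ (htr _ _
      (isConj_shintaniNorm_nonsplit (two_ne_zero_of_ringChar hp) hγ hN k))
    rw [map_mul, map_mul]
    rfl
  rw [← hcε, ← map_smul, hc, LinearMap.comp_apply, ← hmul]
  simp

end

theorem epsilonSign_antiDiag_restrict {F W : Type*} [Field F] [AddCommGroup W] [Module ℂ W]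
    (τ : Representation ℂ (PGL2 F) W) (β : Fˣ) :
    (τ (toPGL2 F (antiDiag β))).restrict (antiDiag_mapsTo τ β) *
      (τ (toPGL2 F (antiDiag β))).restrict (antiDiag_mapsTo τ β) = 1 := by
  ext w
  have h : τ (toPGL2 F (antiDiag β)) (τ (toPGL2 F (antiDiag β)) w) = w := by
    rw [← Module.End.mul_apply, ← map_mul, ← map_mul, toPGL2_antiDiag_mul_self, map_one,
      Module.End.one_apply]
  exact h

/-- If `ε_τ = ± dim τ^H`, then `τ^H` is at most a line. -/
theorem finrank_splitTorus_le_one_of_epsilonSign {F W : Type*} [Field F] [Fintype F]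
    [AddCommGroup W] [Module ℂ W] [FiniteDimensional ℂ W] {τ : Representation ℂ (PGL2 F) W}
    (hτ : τ.IsIrreducible) (β : Fˣ)
    (h : epsilonSign τ β ^ 2 = (Module.finrank ℂ (fixedVectors τ (splitTorus F)) : ℂ) ^ 2) :
    Module.finrank ℂ (fixedVectors τ (splitTorus F)) ≤ 1 := by
  rcases involution_eq_one_or_neg_one (epsilonSign_antiDiag_restrict τ β) h with hA | hA
  · exact finrank_splitTorus_le_one hτ β (s := 1) (by norm_num) fun u hu => by
      rw [one_smul]
      exact congrArg Subtype.val congr($hA ⟨u, hu⟩)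
  · exact finrank_splitTorus_le_one hτ β (s := -1) (by norm_num) fun u hu => by
      rw [neg_one_smul]
      exact congrArg Subtype.val congr($hA ⟨u, hu⟩)

end

end ToricBC

theorem theorem1p8 {F E : Type*} [Field F] [Fintype F] [Field E] [Fintype E] [Algebra F E]
    (hp : ringChar F ≠ 2)
    -- the non-squares defining `K ⊆ PGL₂(E)` and the element `k₀ ∈ PGL₂(F)`
    (α : E) (hα : ¬ IsSquare α) (β : Fˣ) (hβ : ¬ IsSquare (β : F))
    -- `π` is an irreducible principal series `Ps(χ, χ⁻¹)` with a `PGL₂(E)`-invariant inner product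
    (χ : Eˣ →* ℂˣ)
    {V : Type*} [NormedAddCommGroup V] [InnerProductSpace ℂ V]
    (π : Representation ℂ (ToricBC.PGL2 E) V)
    (hπ : π.IsIrreducible)
    (hPs : Nonempty (π.Equiv (ToricBC.principalSeries χ)))
    (hinv : ∀ (g : ToricBC.PGL2 E) (v w : V), inner ℂ (π g v) (π g w) = inner ℂ v w)
    -- `π` is the base change of the irreducible `τ`
    {W : Type*} [AddCommGroup W] [Module ℂ W] [FiniteDimensional ℂ W]
    (τ : Representation ℂ (ToricBC.PGL2 F) W)
    (hτ : τ.IsIrreducible)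
    (hbc : ToricBC.IsShintaniBaseChange τ π)
    -- unit vectors fixed by the split torus `H` and by the non-split torus `K`
    (vH vK : V)
    (hvH : vH ∈ ToricBC.fixedVectors π (ToricBC.splitTorus E)) (hvH1 : ‖vH‖ = 1)
    (hvK : vK ∈ ToricBC.fixedVectors π (ToricBC.nonsplitTorus α)) (hvK1 : ‖vK‖ = 1) :
    inner ℂ vH vK = ToricBC.epsilonSign τ β * inner ℂ vH vK ∧
      (ToricBC.epsilonSign τ β = -1 → inner ℂ vH vK = 0) := by
  suffices h : inner ℂ vH vK = ToricBC.epsilonSign τ β * inner ℂ vH vK by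
    refine ⟨h, fun hε => ?_⟩
    rw [hε] at h
    linear_combination h / 2
  obtain ⟨e⟩ := hPs
  have := ToricBC.finiteDimensional_of_equiv e
  obtain ⟨T, hT, htr⟩ := hbc
  have hH0 : vH ≠ 0 := norm_ne_zero_iff.1 (by rw [hvH1]; exact one_ne_zero)
  have hK0 : vK ≠ 0 := norm_ne_zero_iff.1 (by rw [hvK1]; exact one_ne_zero)
  have hTH := ToricBC.map_splitTorus_vector hT htr hH0 hvH
    (ToricBC.fixedVectors_splitTorus_eq_span hπ e hvH hH0)
  obtain ⟨γ, hTK⟩ := ToricBC.map_nonsplitTorus_vector hp hT htr hα β hK0 hvK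
    (ToricBC.fixedVectors_nonsplitTorus_eq_span hα e hvK hK0)
  obtain ⟨r, hr⟩ := ToricBC.exists_inner_map_map hπ hinv T fun g => by
    obtain ⟨x, rfl⟩ := QuotientGroup.mk'_surjective _ g
    exact ⟨_, hinv _, fun v => congr($(hT x) v)⟩
  set n := Module.finrank ℂ (ToricBC.fixedVectors τ (ToricBC.splitTorus F)) with hn
  set ε := ToricBC.epsilonSign τ β with hε
  obtain ⟨m, hm⟩ : ∃ m : ℤ, ε = m :=
    ToricBC.trace_involution (ToricBC.epsilonSign_antiDiag_restrict τ β)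
  -- The trace of an involution is an integer, so `ε` is real and the conjugate-linear slot of the
  -- inner product causes no change.
  have hεconj : starRingEnd ℂ ε = ε := by rw [hm, map_intCast]
  have hHH : inner ℂ vH vH = (1 : ℂ) := by rw [inner_self_eq_norm_sq_to_K, hvH1]; simp
  have hKK : inner ℂ vK vK = (1 : ℂ) := by rw [inner_self_eq_norm_sq_to_K, hvK1]; simp
  have hrn : r = (n : ℂ) ^ 2 := by
    have := hr vH vH
    rw [hTH, inner_smul_left, inner_smul_right, map_natCast, hHH] at this
    linear_combination -this
  have hrε : r = ε ^ 2 := by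
    have := hr vK vK
    rw [hTK, inner_smul_left, inner_smul_right, hinv, hεconj, hKK] at this
    linear_combination -this
  have hHγ : π (ToricBC.toPGL2 E (ToricBC.diagHom E γ)) vH = vH :=
    hvH _ ⟨_, ToricBC.diagHom_mem γ, rfl⟩
  have hHK : r * inner ℂ vH vK = n * ε * inner ℂ vH vK := by
    rw [← hr, hTH, hTK, inner_smul_left, inner_smul_right, map_natCast]
    -- As `diag(γ,1)` fixes `vH`, unitarity removes it from the pairing.
    nth_rewrite 1 [← hHγ]
    rw [hinv, mul_assoc]
  have hr0 : r ≠ 0 := by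
    intro hr0
    have hT0 : T = 0 := by
      ext v
      have := hr v v
      rw [hr0, zero_mul, inner_self_eq_zero] at this
      exact this
    -- At the identity the trace identity reads `Trace T = dim W`, which is nonzero.
    have h1 := htr 1 1 (by
      rw [← map_one (ToricBC.diagHom E), ToricBC.shintaniNorm_diagHom, map_one, map_one, map_one])
    have := ToricBC.nontrivial_of_isIrreducible hτ
    rw [hT0, LinearMap.comp_zero, map_zero, map_one, map_one, LinearMap.trace_one] at h1
    exact Module.finrank_pos.ne' (Nat.cast_eq_zero.1 h1.symm)
  have hn1 : n = 1 := by
    have hle := ToricBC.finrank_splitTorus_le_one_of_epsilonSign hτ β (hrε.symm.trans hrn)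
    have hn0 : n ≠ 0 := by
      rintro h0
      rw [h0] at hrn
      exact hr0 (by rw [hrn]; simp)
    omega
  rw [hn1, Nat.cast_one] at hrn hHK
  rw [hrn] at hHK
  linear_combination hHK
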